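/- Let $n$ be a positive integer and write $M_d$ for the algebra of complex $d\times d$ matrices. Let $\phi_1$ and $\phi_2$ be linear maps $M_3\to M_3$ (not assumed trace preserving) such that $\phi_2$ is completely positive and $\phi_1$ is a PPT map, that is, both $\phi_1$ and $X\mapsto \phi_1(X)^{T}$ are completely positive. Let $\rho\in M_n\otimes M_3$ be a bipartite state, that is, a positive semidefinite matrix (normalized or not), and let $I_n$ denote the identity map of $M_n$. Suppose that $(I_n\otimes\phi_2)(\rho)$ has Schmidt number at most two, that is, it is a finite sum $\sum_j p_j|\psi_j\rangle\langle\psi_j|$ with $p_j\ge 0$ and vectors $|\psi_j\rangle\in\mathbb{C}^n\otimes\mathbb{C}^3$ of Schmidt rank at most two. Then $(I_n\otimes(\phi_1\circ\phi_2))(\rho)$ is separable, that is, it is a finite sum $\sum_j A_j\otimes B_j$ with positive semidefinite $A_j\in M_n$ and $B_j\in M_3$. -/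

import Mathlib

open scoped Matrix Kronecker ComplexOrder

/-- The space of complex square matrices of order `n` is `Matrix (Fin n) (Fin n) ℂ`; an operator
on `ℂⁿ ⊗ ℂᵐ` is a matrix indexed by `Fin n × Fin m`, the Kronecker product being `⊗ₖ`.

`idTensor n φ` is the map `I_n ⊗ φ`: it applies `φ` to each of the `n × n` blocks, so that
`idTensor n φ (A ⊗ₖ B) = A ⊗ₖ φ B`. -/
def idTensor (n : ℕ) {m p : ℕ} (φ : Matrix (Fin m) (Fin m) ℂ →ₗ[ℂ] Matrix (Fin p) (Fin p) ℂ) :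
    Matrix (Fin n × Fin m) (Fin n × Fin m) ℂ →ₗ[ℂ] Matrix (Fin n × Fin p) (Fin n × Fin p) ℂ where
  toFun ρ := Matrix.of fun x y =>
    φ (Matrix.of fun a b => ρ (x.1, a) (y.1, b)) x.2 y.2
  map_add' ρ σ := by
    ext x y
    exact congrFun (congrFun (φ.map_add (Matrix.of fun a b => ρ (x.1, a) (y.1, b))
      (Matrix.of fun a b => σ (x.1, a) (y.1, b))) x.2) y.2
  map_smul' c ρ := by
    ext x y
    exact congrFun (congrFun (φ.map_smul c (Matrix.of fun a b => ρ (x.1, a) (y.1, b))) x.2) y.2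

/-- `φ` is completely positive: `I_k ⊗ φ` preserves positive semidefiniteness for all `k`. -/
def IsCompletelyPositive {m p : ℕ}
    (φ : Matrix (Fin m) (Fin m) ℂ →ₗ[ℂ] Matrix (Fin p) (Fin p) ℂ) : Prop :=
  ∀ (k : ℕ) (ρ : Matrix (Fin k × Fin m) (Fin k × Fin m) ℂ),
    ρ.PosSemidef → (idTensor k φ ρ).PosSemidef

/-- `φ` is completely copositive: `X ↦ (φ X)ᵀ` is completely positive. -/
def IsCompletelyCopositive {m p : ℕ}
    (φ : Matrix (Fin m) (Fin m) ℂ →ₗ[ℂ] Matrix (Fin p) (Fin p) ℂ) : Prop :=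
  IsCompletelyPositive
    ((Matrix.transposeLinearEquiv (Fin p) (Fin p) ℂ ℂ).toLinearMap ∘ₗ φ)

/-- A PPT map: both completely positive and completely copositive. -/
def IsPPTMap {m p : ℕ}
    (φ : Matrix (Fin m) (Fin m) ℂ →ₗ[ℂ] Matrix (Fin p) (Fin p) ℂ) : Prop :=
  IsCompletelyPositive φ ∧ IsCompletelyCopositive φ

/-- The Schmidt rank of a vector of `ℂⁿ ⊗ ℂᵐ` is the rank of its `n × m` coefficient matrix. -/
noncomputable def schmidtRank {n m : ℕ} (ψ : Fin n × Fin m → ℂ) : ℕ :=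
  (Matrix.of fun i a => ψ (i, a)).rank

/-- A (not necessarily normalized) bipartite state has Schmidt number at most `k` if it is a
finite sum `∑ j, |ψ j⟩⟨ψ j|` with all `ψ j` of Schmidt rank at most `k`. The vectors need not be
unit vectors, so nonnegative weights are absorbed in them. -/
def SchmidtNumberLE {n m : ℕ} (k : ℕ) (σ : Matrix (Fin n × Fin m) (Fin n × Fin m) ℂ) : Prop :=
  ∃ (r : ℕ) (ψ : Fin r → Fin n × Fin m → ℂ),
    (∀ j, schmidtRank (ψ j) ≤ k) ∧ σ = ∑ j, Matrix.vecMulVec (ψ j) (star (ψ j))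

/-- A (not necessarily normalized) bipartite state is separable if it is a finite sum of tensor
products of positive semidefinite matrices; nonnegative weights are absorbed in the factors. -/
def IsSeparableState {n m : ℕ} (σ : Matrix (Fin n × Fin m) (Fin n × Fin m) ℂ) : Prop :=
  ∃ (r : ℕ) (A : Fin r → Matrix (Fin n) (Fin n) ℂ) (B : Fin r → Matrix (Fin m) (Fin m) ℂ),
    (∀ j, (A j).PosSemidef) ∧ (∀ j, (B j).PosSemidef) ∧ σ = ∑ j, A j ⊗ₖ B j

/-!
After applying `φ₂` the state is a sum of rank one operators `ψ ψᴴ` with `ψ` of Schmidt rank at most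
two, so `ψ` lives on `ℂ² ⊗ ℂ³` up to a local map. A PPT map sends such an operator to one on
`ℂ² ⊗ ℂ³` which is positive semidefinite together with its partial transpose. The result is
therefore the Størmer–Woronowicz theorem (`sepOfPPT`): such operators are separable.

Write the operator in blocks `[[A, Cᴴ], [C, B]]`; partial transposition replaces `C` by `Cᴴ`. The
induction is on the dimension `n ≤ 3` of the second factor and on the sum `r + s` of (bounds for) the
ranks of the operator and of its partial transpose.

* If `B` is singular, a kernel vector of `B` splits off (`mem_sepCone_of_det_eq_zero`).
* If `r² + s² ≥ 4n² + 2`, a dimension count gives a perturbation within both ranges, and the operator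
  is a combination of two operators of smaller total rank (`mem_sepCone_of_large`).
* Otherwise normalize `B = 1`, so that the two positivity conditions read `A ≥ Cᴴ C` and
  `A ≥ C Cᴴ`. If one of the ranks is `n`, then `A = Cᴴ C` and `C` is normal by comparing traces, and
  the spectral theorem gives a separable decomposition. The only other possibility is `n = 3`,
  `r = s = 4`, that is `A = Cᴴ C + v vᴴ = C Cᴴ + u uᴴ`. Here `C` has a normal dilation
  `[[C, u], [vᴴ, w]]` after a change of the phase of `v`
  (`mem_sepCone_of_rank_one_defects`): this needs `Cᴴ u - C v = w̄ u - w v`, where the difference can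
  be moved into the span of `u` and `v` because `det [u, v, Cᴴ u]` and `det [u, v, C v]` have the same
  modulus, and the coefficients are then automatically of the required form.
-/

/-! ### The separable cone on a qubit and a finite-dimensional space -/

/-- The cone of separable operators on `ℂ² ⊗ ℂⁿ`. A Hermitian operator is encoded by the triple
`(A, C, B)` of its blocks `[[A, Cᴴ], [C, B]]`; in this encoding the product `x xᴴ ⊗ P` with
`x = (a, b)` is `(|a|² P, b ā P, |b|² P)`. -/
def sepCone (n : Type*) [Fintype n] :
    AddSubmonoid (Matrix n n ℂ × Matrix n n ℂ × Matrix n n ℂ) :=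
  AddSubmonoid.closure
    {T | ∃ (a b : ℂ) (P : Matrix n n ℂ), P.PosSemidef ∧
      T = ((a * star a) • P, (b * star a) • P, (b * star b) • P)}

section sepCone

variable {m n : Type*} [Fintype m] [Fintype n]

theorem mem_sepCone_of_posSemidef {P : Matrix n n ℂ} (hP : P.PosSemidef) (a b : ℂ) :
    ((a * star a) • P, (b * star a) • P, (b * star b) • P) ∈ sepCone n :=
  AddSubmonoid.subset_closure ⟨a, b, P, hP, rfl⟩

theorem mem_sepCone_fst {P : Matrix n n ℂ} (hP : P.PosSemidef) :
    (P, (0 : Matrix n n ℂ), (0 : Matrix n n ℂ)) ∈ sepCone n := by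
  have := mem_sepCone_of_posSemidef hP 1 0
  rwa [star_zero, star_one, zero_mul, zero_mul, mul_one, one_smul, zero_smul] at this

theorem conj_mem_sepCone (S : Matrix m n ℂ) {A C B : Matrix n n ℂ}
    (h : (A, C, B) ∈ sepCone n) : (S * A * Sᴴ, S * C * Sᴴ, S * B * Sᴴ) ∈ sepCone m := by
  suffices H : ∀ T ∈ sepCone n, (S * T.1 * Sᴴ, S * T.2.1 * Sᴴ, S * T.2.2 * Sᴴ) ∈ sepCone m from
    H (A, C, B) h
  intro T hT
  induction hT using AddSubmonoid.closure_induction with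
  | mem T hT =>
    obtain ⟨a, b, P, hP, rfl⟩ := hT
    simp only [Matrix.mul_smul, Matrix.smul_mul]
    exact mem_sepCone_of_posSemidef (hP.mul_mul_conjTranspose_same S) a b
  | zero =>
    simp only [Prod.fst_zero, Prod.snd_zero, Matrix.mul_zero, Matrix.zero_mul]
    exact zero_mem _
  | add T U _ _ hT hU => simpa [Matrix.mul_add, Matrix.add_mul] using add_mem hT hU

theorem smul_mem_sepCone {A C B : Matrix n n ℂ} {c : ℝ} (hc : 0 ≤ c)
    (h : (A, C, B) ∈ sepCone n) : ((c : ℂ) • A, (c : ℂ) • C, (c : ℂ) • B) ∈ sepCone n := by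
  classical
  have hs : (Real.sqrt c : ℂ) * Real.sqrt c = c := by
    exact_mod_cast Real.mul_self_sqrt hc
  have := conj_mem_sepCone ((Real.sqrt c : ℂ) • (1 : Matrix n n ℂ)) h
  simpa only [Matrix.smul_mul, Matrix.one_mul, Matrix.conjTranspose_smul, Matrix.mul_smul,
    Matrix.conjTranspose_one, Matrix.mul_one, smul_smul, Complex.star_def, Complex.conj_ofReal,
    hs] using this

/-- The partial transpose on the qubit, `C ↦ Cᴴ`, preserves separability. -/
theorem conjTranspose_mem_sepCone {A C B : Matrix n n ℂ}
    (h : (A, C, B) ∈ sepCone n) : (A, Cᴴ, B) ∈ sepCone n := by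
  suffices H : ∀ T ∈ sepCone n, (T.1, T.2.1ᴴ, T.2.2) ∈ sepCone n from H (A, C, B) h
  intro T hT
  induction hT using AddSubmonoid.closure_induction with
  | mem T hT =>
    obtain ⟨a, b, P, hP, rfl⟩ := hT
    simpa [hP.1.eq, mul_comm] using mem_sepCone_of_posSemidef hP (star a) (star b)
  | zero => simp only [Prod.fst_zero, Prod.snd_zero, Matrix.conjTranspose_zero]; exact zero_mem _
  | add T U _ _ hT hU => simpa using add_mem hT hU

open scoped Matrix.Norms.L2Operator in
/-- If `M` is normal with spectral projections `p z`, then `[[Mᴴ M, Mᴴ], [M, 1]]` is the sum of the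
products `x xᴴ ⊗ p z` with `x = (z̄, 1)`. -/
theorem mem_sepCone_of_normal [DecidableEq n] {M : Matrix n n ℂ} (hM : Mᴴ * M = M * Mᴴ) :
    (Mᴴ * M, M, 1) ∈ sepCone n := by
  let : CStarAlgebra (Matrix n n ℂ) := { }
  have hn : IsStarNormal M := ⟨hM⟩
  have hfin : (spectrum ℂ M).Finite := Matrix.finite_spectrum M
  have hcont (f : ℂ → ℂ) : ContinuousOn f (spectrum ℂ M) := hfin.continuousOn f
  let p : ℂ → Matrix n n ℂ := fun z => cfc (fun w => if w = z then 1 else 0) M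
  -- `p z` is the spectral projection of `M` at `z`; the spectrum is finite, so every function is
  -- continuous on it and the continuous functional calculus applies to indicator functions.
  have hp (z : ℂ) : (p z).PosSemidef := by
    have : p z = (p z)ᴴ * p z := by
      simp only [p, ← Matrix.star_eq_conjTranspose]
      rw [← cfc_star, ← cfc_mul _ _ M (hcont _) (hcont _)]
      congr 1
      ext w
      split_ifs <;> simp
    rw [this]
    exact Matrix.posSemidef_conjTranspose_mul_self _
  have hsum (f : ℂ → ℂ) : cfc f M = ∑ z ∈ hfin.toFinset, f z • p z := by
    calc cfc f M = cfc (∑ z ∈ hfin.toFinset, fun w => f z * if w = z then 1 else 0) M := by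
          refine cfc_congr fun w hw => ?_
          simp [hw]
      _ = _ := by
          rw [cfc_sum _ _ _ fun _ _ => hcont _]
          exact Finset.sum_congr rfl fun z _ => cfc_const_mul _ _ M (hcont _)
  have h1 : (1 : Matrix n n ℂ) = ∑ z ∈ hfin.toFinset, ((1 : ℂ) * star 1) • p z := by
    simpa [cfc_one ℂ M] using hsum 1
  have h2 : M = ∑ z ∈ hfin.toFinset, ((1 : ℂ) * star (star z)) • p z := by
    simpa [cfc_id ℂ M] using hsum id
  have h3 : Mᴴ * M = ∑ z ∈ hfin.toFinset, (star z * star (star z)) • p z := by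
    rw [← hsum fun z => star z * star (star z), cfc_mul _ _ M (hcont _) (hcont _)]
    simp only [star_star]
    rw [cfc_star_id (R := ℂ) (a := M), cfc_id' ℂ M, Matrix.star_eq_conjTranspose]
  have key : (Mᴴ * M, M, (1 : Matrix n n ℂ)) = ∑ z ∈ hfin.toFinset,
      ((star z * star (star z)) • p z, ((1 : ℂ) * star (star z)) • p z,
        ((1 : ℂ) * star 1) • p z) := by
    rw [Prod.ext_iff, Prod.ext_iff]
    simp only [Prod.fst_sum, Prod.snd_sum]
    exact ⟨h3, h2, h1⟩
  rw [key]
  exact sum_mem fun z _ => mem_sepCone_of_posSemidef (hp z) (star z) 1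

end sepCone

/-! ### Gram factors of Hermitian matrices and the dimension count -/

/-- A singular Hermitian matrix of order `k + 1` has a unit kernel vector `y`, and `V` is an isometry
of `ℂᵏ` onto the orthogonal complement of `y`. -/
theorem exists_isometry_of_det_eq_zero {k : ℕ} {B : Matrix (Fin (k + 1)) (Fin (k + 1)) ℂ}
    (hB : B.IsHermitian) (hdet : B.det = 0) :
    ∃ (V : Matrix (Fin (k + 1)) (Fin k) ℂ) (y : Fin (k + 1) → ℂ),
      Vᴴ * V = 1 ∧ V * Vᴴ + Matrix.vecMulVec y (star y) = 1 ∧ star y ⬝ᵥ y = 1 ∧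
        B *ᵥ y = 0 := by
  obtain ⟨i, hi⟩ : ∃ i, hB.eigenvalues i = 0 := by
    rw [hB.det_eq_prod_eigenvalues, Finset.prod_eq_zero_iff] at hdet
    obtain ⟨i, -, hi⟩ := hdet
    exact ⟨i, Complex.ofReal_eq_zero.mp hi⟩
  set U : Matrix (Fin (k + 1)) (Fin (k + 1)) ℂ := hB.eigenvectorUnitary.1 with hU
  have hU1 : Uᴴ * U = 1 := Unitary.coe_star_mul_self hB.eigenvectorUnitary
  have hU2 : U * Uᴴ = 1 := Unitary.coe_mul_star_self hB.eigenvectorUnitary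
  refine ⟨U.submatrix id i.succAbove, fun a => U a i, ?_, ?_, ?_, ?_⟩
  · ext a b
    have := congrFun (congrFun hU1 (i.succAbove a)) (i.succAbove b)
    simpa [Matrix.mul_apply, Matrix.one_apply] using this
  · ext a b
    have := congrFun (congrFun hU2 a) b
    simp only [Matrix.mul_apply, Matrix.conjTranspose_apply] at this
    rw [Fin.sum_univ_succAbove _ i] at this
    rw [← this]
    simp [Matrix.mul_apply, Matrix.vecMulVec_apply, add_comm]
  · have := congrFun (congrFun hU1 i) i
    simpa [Matrix.mul_apply, dotProduct] using this
  · have := hB.mulVec_eigenvectorBasis i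
    rw [hi, zero_smul] at this
    exact this

theorem exists_eq_mul_conjTranspose {n : Type*} [Fintype n] {H : Matrix n n ℂ}
    (hH : H.PosSemidef) : ∃ R : Matrix n n ℂ, H = R * Rᴴ := by
  classical
  open scoped MatrixOrder Matrix.Norms.L2Operator in
  obtain ⟨R, hR⟩ := CStarAlgebra.nonneg_iff_eq_mul_star_self.mp hH.nonneg
  exact ⟨R, hR⟩

/-- A matrix that vanishes on `y`, together with its adjoint, is recovered from its compression to the
orthogonal complement of `y`. -/
theorem conj_compress_eq {m n : Type*} [Fintype m] [Fintype n] [DecidableEq n]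
    {V : Matrix n m ℂ} {y : n → ℂ} (hV : V * Vᴴ + Matrix.vecMulVec y (star y) = 1)
    {X : Matrix n n ℂ} (hX : X *ᵥ y = 0) (hX' : Xᴴ *ᵥ y = 0) : V * (Vᴴ * X * V) * Vᴴ = X := by
  have h1 {X : Matrix n n ℂ} (hX : X *ᵥ y = 0) : X * (V * Vᴴ) = X := by
    rw [eq_sub_of_add_eq hV, Matrix.mul_sub, Matrix.mul_vecMulVec, hX]
    simp
  have h2 : V * Vᴴ * X = X := by
    simpa [Matrix.mul_assoc] using congrArg Matrix.conjTranspose (h1 hX')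
  rw [← Matrix.mul_assoc, ← Matrix.mul_assoc, h2, Matrix.mul_assoc, h1 hX]

/-- A singular positive semidefinite matrix has a Gram factor with one column fewer. -/
theorem exists_eq_mul_conjTranspose_of_det_eq_zero {k : ℕ}
    {H : Matrix (Fin (k + 1)) (Fin (k + 1)) ℂ} (hH : H.PosSemidef) (hdet : H.det = 0) :
    ∃ G : Matrix (Fin (k + 1)) (Fin k) ℂ, H = G * Gᴴ := by
  obtain ⟨V, y, -, hV, -, hy⟩ := exists_isometry_of_det_eq_zero hH.1 hdet
  obtain ⟨R, hR⟩ := exists_eq_mul_conjTranspose (hH.conjTranspose_mul_mul_same V)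
  refine ⟨V * R, ?_⟩
  rw [← conj_compress_eq hV hy (by rwa [hH.1.eq]), hR, Matrix.conjTranspose_mul]
  simp only [Matrix.mul_assoc]

theorem posSemidef_sub_smul_one {n : Type*} [Fintype n] [DecidableEq n] {H : Matrix n n ℂ}
    (hH : H.IsHermitian) {μ : ℝ} (hμ : ∀ i, μ ≤ hH.eigenvalues i) :
    (H - (μ : ℂ) • 1).PosSemidef := by
  set U : Matrix n n ℂ := hH.eigenvectorUnitary.1 with hU
  have hU2 : U * Uᴴ = 1 := Unitary.coe_mul_star_self hH.eigenvectorUnitary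
  have key : H - (μ : ℂ) • 1 =
      U * Matrix.diagonal (fun i => ((hH.eigenvalues i - μ : ℝ) : ℂ)) * Uᴴ := by
    have h1 : H = U * Matrix.diagonal (fun i => (hH.eigenvalues i : ℂ)) * Uᴴ := by
      conv_lhs => rw [hH.spectral_theorem, Unitary.conjStarAlgAut_apply]
      rfl
    have h2 : Matrix.diagonal (fun i => ((hH.eigenvalues i - μ : ℝ) : ℂ)) =
        Matrix.diagonal (fun i => (hH.eigenvalues i : ℂ)) - (μ : ℂ) • 1 := by
      rw [Matrix.smul_one_eq_diagonal, Matrix.diagonal_sub]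
      simp
    rw [h2, Matrix.mul_sub, Matrix.sub_mul, ← h1]
    simp [hU2]
  rw [key]
  refine Matrix.PosSemidef.mul_mul_conjTranspose_same (Matrix.PosSemidef.diagonal fun i => ?_) _
  simpa using hμ i

theorem det_sub_eigenvalue_eq_zero {n : Type*} [Fintype n] [DecidableEq n] {H : Matrix n n ℂ}
    (hH : H.IsHermitian) (i : n) : (H - (hH.eigenvalues i : ℂ) • 1).det = 0 := by
  rw [← Matrix.exists_mulVec_eq_zero_iff]
  refine ⟨hH.eigenvectorBasis i, ?_, ?_⟩
  · intro h
    apply hH.eigenvectorBasis.orthonormal.ne_zero i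
    ext j
    exact congrFun h j
  · rw [Matrix.sub_mulVec, hH.mulVec_eigenvectorBasis, Matrix.smul_mulVec, Matrix.one_mulVec]
    ext j
    simp

/-- The shift `μ` is the smallest eigenvalue of `H ⊕ K`. -/
theorem exists_common_shift {r s : ℕ} (hrs : 0 < r + s) {H : Matrix (Fin r) (Fin r) ℂ}
    {K : Matrix (Fin s) (Fin s) ℂ} (hH : H.IsHermitian) (hK : K.IsHermitian) :
    ∃ μ : ℝ, (H - (μ : ℂ) • 1).PosSemidef ∧ (K - (μ : ℂ) • 1).PosSemidef ∧
      ((H - (μ : ℂ) • 1).det = 0 ∨ (K - (μ : ℂ) • 1).det = 0) := by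
  have : Nonempty (Fin r ⊕ Fin s) := by
    rw [← Fintype.card_pos_iff]
    simpa using hrs
  obtain ⟨i, hi⟩ := Finite.exists_min (Sum.elim hH.eigenvalues hK.eigenvalues)
  refine ⟨Sum.elim hH.eigenvalues hK.eigenvalues i,
    posSemidef_sub_smul_one hH fun j => hi (Sum.inl j),
    posSemidef_sub_smul_one hK fun j => hi (Sum.inr j), ?_⟩
  cases i with
  | inl i => exact Or.inl (det_sub_eigenvalue_eq_zero hH i)
  | inr i => exact Or.inr (det_sub_eigenvalue_eq_zero hK i)

theorem exists_fewer_columns {r s : ℕ} {H : Matrix (Fin r) (Fin r) ℂ}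
    {K : Matrix (Fin s) (Fin s) ℂ} (hH : H.PosSemidef) (hK : K.PosSemidef)
    (h : H.det = 0 ∨ K.det = 0) :
    ∃ (r' s' : ℕ) (G : Matrix (Fin r) (Fin r') ℂ) (L : Matrix (Fin s) (Fin s') ℂ),
      r' + s' < r + s ∧ H = G * Gᴴ ∧ K = L * Lᴴ := by
  rcases h with h | h
  · obtain _ | k := r
    · simp at h
    · obtain ⟨G, hG⟩ := exists_eq_mul_conjTranspose_of_det_eq_zero hH h
      obtain ⟨L, hL⟩ := exists_eq_mul_conjTranspose hK
      exact ⟨k, s, G, L, by omega, hG, hL⟩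
  · obtain _ | k := s
    · simp at h
    · obtain ⟨G, hG⟩ := exists_eq_mul_conjTranspose hH
      obtain ⟨L, hL⟩ := exists_eq_mul_conjTranspose_of_det_eq_zero hK h
      exact ⟨r, k, G, L, by omega, hG, hL⟩

/-- A matrix whose real and imaginary parts are both scalar is scalar. -/
theorem eq_smul_one_of_re_im {n : Type*} [DecidableEq n] {X : Matrix n n ℂ} {c d : ℝ}
    (h1 : (1 : ℂ) • X + star (1 : ℂ) • Xᴴ = (c : ℂ) • 1)
    (h2 : Complex.I • X + star Complex.I • Xᴴ = (d : ℂ) • 1) :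
    (((c : ℂ) - Complex.I * d) / 2) • (1 : Matrix n n ℂ) = X := by
  ext i j
  have h1 := congrFun (congrFun h1 i) j
  have h2 := congrFun (congrFun h2 i) j
  simp only [Matrix.add_apply, Matrix.smul_apply, smul_eq_mul, star_one, Complex.star_def,
    Complex.conj_I, one_mul] at h1 h2 ⊢
  linear_combination (-1 / 2 : ℂ) * h1 + (Complex.I / 2) * h2 -
    ((X i j - Xᴴ i j) / 2) * Complex.I_sq

/-- For `r² + s² ≥ 4n² + 2` there is a Hermitian perturbation `Y H Yᴴ` of `Y Yᴴ` inside its range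
whose partial transpose is of the form `Z K Zᴴ`, with `(H, K)` not a scalar pair. The four block equations are
`4n²` linear conditions on the `r² + s²` entries of `(H, K)`, so the solution space has dimension
at least two; it is closed under adjoints, hence has a Hermitian element outside the line of scalar
pairs. -/
theorem exists_hermitian_pair {n r s : ℕ} (Y₁ Y₂ : Matrix (Fin n) (Fin r) ℂ)
    (Z₁ Z₂ : Matrix (Fin n) (Fin s) ℂ) (h : 4 * n ^ 2 + 2 ≤ r ^ 2 + s ^ 2) :
    ∃ (H : Matrix (Fin r) (Fin r) ℂ) (K : Matrix (Fin s) (Fin s) ℂ),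
      H.IsHermitian ∧ K.IsHermitian ∧ (¬ ∃ c : ℝ, H = (c : ℂ) • 1 ∧ K = (c : ℂ) • 1) ∧
      Y₁ * H * Y₁ᴴ = Z₁ * K * Z₁ᴴ ∧ Y₂ * H * Y₂ᴴ = Z₂ * K * Z₂ᴴ ∧
      Y₂ * H * Y₁ᴴ = Z₁ * K * Z₂ᴴ := by
  obtain ⟨Λ, hΛ⟩ : ∃ Λ : (Matrix (Fin r) (Fin r) ℂ × Matrix (Fin s) (Fin s) ℂ) →ₗ[ℂ]
      Matrix (Fin n) (Fin n) ℂ × Matrix (Fin n) (Fin n) ℂ × Matrix (Fin n) (Fin n) ℂ ×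
        Matrix (Fin n) (Fin n) ℂ, ∀ H K, Λ (H, K) =
        (Y₁ * H * Y₁ᴴ - Z₁ * K * Z₁ᴴ, Y₂ * H * Y₂ᴴ - Z₂ * K * Z₂ᴴ,
          Y₂ * H * Y₁ᴴ - Z₁ * K * Z₂ᴴ, Y₁ * H * Y₂ᴴ - Z₂ * K * Z₁ᴴ) := by
    refine ⟨{ toFun := fun T => (Y₁ * T.1 * Y₁ᴴ - Z₁ * T.2 * Z₁ᴴ, Y₂ * T.1 * Y₂ᴴ - Z₂ * T.2 * Z₂ᴴ,
        Y₂ * T.1 * Y₁ᴴ - Z₁ * T.2 * Z₂ᴴ, Y₁ * T.1 * Y₂ᴴ - Z₂ * T.2 * Z₁ᴴ)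
              map_add' := fun a b => ?_
              map_smul' := fun c a => ?_ }, fun _ _ => rfl⟩
    · simp only [Prod.fst_add, Prod.snd_add, Matrix.mul_add, Matrix.add_mul, Prod.mk_add_mk,
          add_sub_add_comm]
    · simp [smul_sub]
  have hmem {H : Matrix (Fin r) (Fin r) ℂ} {K : Matrix (Fin s) (Fin s) ℂ} :
      (H, K) ∈ LinearMap.ker Λ ↔ Y₁ * H * Y₁ᴴ = Z₁ * K * Z₁ᴴ ∧ Y₂ * H * Y₂ᴴ = Z₂ * K * Z₂ᴴ ∧
        Y₂ * H * Y₁ᴴ = Z₁ * K * Z₂ᴴ ∧ Y₁ * H * Y₂ᴴ = Z₂ * K * Z₁ᴴ := by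
    simp [hΛ, sub_eq_zero]
  have hstar {H : Matrix (Fin r) (Fin r) ℂ} {K : Matrix (Fin s) (Fin s) ℂ}
      (h : (H, K) ∈ LinearMap.ker Λ) : (Hᴴ, Kᴴ) ∈ LinearMap.ker Λ := by
    rw [hmem] at h ⊢
    obtain ⟨h1, h2, h3, h4⟩ := h
    refine ⟨?_, ?_, ?_, ?_⟩
    · simpa [Matrix.mul_assoc] using congrArg Matrix.conjTranspose h1
    · simpa [Matrix.mul_assoc] using congrArg Matrix.conjTranspose h2
    · simpa [Matrix.mul_assoc] using congrArg Matrix.conjTranspose h4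
    · simpa [Matrix.mul_assoc] using congrArg Matrix.conjTranspose h3
  have hdim : 2 ≤ Module.finrank ℂ (LinearMap.ker Λ) := by
    have h1 := LinearMap.finrank_range_add_finrank_ker Λ
    have h2 := Submodule.finrank_le (LinearMap.range Λ)
    simp only [Module.finrank_prod, Module.finrank_matrix, Fintype.card_fin,
      Module.finrank_self] at h1 h2
    nlinarith
  obtain ⟨⟨H, K⟩, hHK, hns⟩ : ∃ T ∈ LinearMap.ker Λ, T ∉ ℂ ∙ ((1 : Matrix (Fin r) (Fin r) ℂ),
      (1 : Matrix (Fin s) (Fin s) ℂ)) := by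
    by_contra! hcon
    have h1 := Submodule.finrank_mono (R := ℂ) hcon
    have h2 := finrank_span_le_card (R := ℂ) {((1 : Matrix (Fin r) (Fin r) ℂ),
      (1 : Matrix (Fin s) (Fin s) ℂ))}
    rw [Set.toFinset_singleton, Finset.card_singleton] at h2
    omega
  have hherm (z : ℂ) : (z • H + star z • Hᴴ, z • K + star z • Kᴴ) ∈ LinearMap.ker Λ :=
    add_mem (Submodule.smul_mem _ z hHK) (Submodule.smul_mem _ (star z) (hstar hHK))
  by_contra hcon
  have hreal (z : ℂ) : ∃ c : ℝ, z • H + star z • Hᴴ = (c : ℂ) • 1 ∧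
      z • K + star z • Kᴴ = (c : ℂ) • 1 := by
    by_contra hc
    obtain ⟨h1, h2, h3, -⟩ := hmem.mp (hherm z)
    refine hcon ⟨_, _, ?_, ?_, hc, h1, h2, h3⟩
    · simp [Matrix.IsHermitian, add_comm]
    · simp [Matrix.IsHermitian, add_comm]
  obtain ⟨c, hc1, hc2⟩ := hreal 1
  obtain ⟨d, hd1, hd2⟩ := hreal Complex.I
  apply hns
  rw [← eq_smul_one_of_re_im hc1 hd1, ← eq_smul_one_of_re_im hc2 hd2, ← Prod.smul_mk]
  exact Submodule.smul_mem _ _ (Submodule.mem_span_singleton_self _)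

open Matrix

/-! ### Normal dilations -/

theorem card_le_of_mul_conjTranspose_eq_one {k r : ℕ} {Y : Matrix (Fin k) (Fin r) ℂ}
    (hY : Y * Yᴴ = 1) : k ≤ r := by
  have h1 := rank_mul_le_right Y Yᴴ
  have h2 := rank_le_height Yᴴ
  rw [hY, rank_one, Fintype.card_fin] at h1
  omega

/-- The projection `1 - Yᴴ Y` has trace one, hence rank one. -/
theorem exists_conjTranspose_mul_add_vecMulVec_eq_one {k : ℕ} {Y : Matrix (Fin k) (Fin (k + 1)) ℂ}
    (hY : Y * Yᴴ = 1) : ∃ w : Fin (k + 1) → ℂ, Yᴴ * Y + vecMulVec w (star w) = 1 := by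
  have hdet : (Yᴴ * Y).det = 0 := by
    by_contra h
    have h1 := rank_of_isUnit (Yᴴ * Y) ((isUnit_iff_isUnit_det _).mpr (isUnit_iff_ne_zero.mpr h))
    have h2 := rank_mul_le_right Yᴴ Y
    have h3 := rank_le_height Y
    rw [Fintype.card_fin] at h1
    omega
  obtain ⟨-, w, -, -, hw, hYw⟩ :=
    exists_isometry_of_det_eq_zero (isHermitian_conjTranspose_mul_self Y) hdet
  rw [conjTranspose_mul_self_mulVec_eq_zero] at hYw
  refine ⟨w, ?_⟩
  set D := 1 - (Yᴴ * Y + vecMulVec w (star w)) with hD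
  have hDH : Dᴴ = D := by simp [hD, conjTranspose_vecMulVec]
  have e1 : Yᴴ * Y * (Yᴴ * Y) = Yᴴ * Y := by
    rw [Matrix.mul_assoc, ← Matrix.mul_assoc Y, hY, Matrix.one_mul]
  have e2 : Yᴴ * Y * vecMulVec w (star w) = 0 := by
    rw [mul_vecMulVec, ← mulVec_mulVec, hYw, mulVec_zero, zero_vecMulVec]
  have e3 : vecMulVec w (star w) * (Yᴴ * Y) = 0 := by
    simpa [conjTranspose_vecMulVec] using congrArg conjTranspose e2
  have e4 : vecMulVec w (star w) * vecMulVec w (star w) = vecMulVec w (star w) := by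
    rw [vecMulVec_mul_vecMulVec, hw, one_smul]
  have hDD : Dᴴ * D = D := by
    rw [hDH, hD]
    simp only [Matrix.mul_sub, Matrix.sub_mul, Matrix.mul_add, Matrix.add_mul, e1, e2, e3, e4,
      Matrix.one_mul, Matrix.mul_one]
    abel
  have htr : (Dᴴ * D).trace = 0 := by
    rw [hDD, hD, trace_sub, trace_add, trace_mul_comm, hY, trace_vecMulVec, dotProduct_comm, hw]
    simp
  rw [trace_conjTranspose_mul_self_eq_zero_iff] at htr
  exact (sub_eq_zero.mp htr).symm

section trace
variable {n : Type*} [Fintype n]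

/-- Here `Cᴴ C - C Cᴴ` is positive semidefinite and has trace zero, so `C` is normal. -/
theorem mem_sepCone_of_defect [DecidableEq n] {A C : Matrix n n ℂ} (hA : A = Cᴴ * C)
    (h : (A - C * Cᴴ).PosSemidef) : (A, C, 1) ∈ sepCone n := by
  have : A - C * Cᴴ = 0 := by
    rw [← h.trace_eq_zero_iff, hA, trace_sub, trace_mul_comm, sub_self]
  rw [hA, sub_eq_zero] at this
  exact hA ▸ mem_sepCone_of_normal this

theorem trace_mul_vecMulVec (X : Matrix n n ℂ) (a b : n → ℂ) :
    (X * vecMulVec a b).trace = b ⬝ᵥ X *ᵥ a := by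
  rw [mul_vecMulVec, trace_vecMulVec, dotProduct_comm]

theorem star_dotProduct_conjTranspose_mulVec (X : Matrix n n ℂ) (a b : n → ℂ) :
    star a ⬝ᵥ Xᴴ *ᵥ b = star (star b ⬝ᵥ X *ᵥ a) := by
  rw [star_dotProduct, star_mulVec, conjTranspose_conjTranspose, dotProduct_mulVec]

/-! Trace identities for a self-commutator `Cᴴ C - C Cᴴ = u uᴴ - v vᴴ`. -/

variable {C : Matrix n n ℂ} {u v : n → ℂ}
  (h : Cᴴ * C + vecMulVec v (star v) = C * Cᴴ + vecMulVec u (star u))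
include h

theorem norm_eq_of_selfCommutator : star v ⬝ᵥ v = star u ⬝ᵥ u := by
  have := congrArg trace h
  rw [trace_add, trace_add, trace_mul_comm, trace_vecMulVec, trace_vecMulVec,
    dotProduct_comm, dotProduct_comm u] at this
  exact add_left_cancel this

theorem inner_mulVec_eq_of_selfCommutator : star v ⬝ᵥ C *ᵥ v = star u ⬝ᵥ C *ᵥ u := by
  -- Multiply by `C` and take traces.
  have := congrArg (fun X => trace (C * X)) h
  simp only [Matrix.mul_add, trace_add, trace_mul_vecMulVec] at this
  rw [← Matrix.mul_assoc, trace_mul_comm] at this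
  exact add_left_cancel this

theorem norm_mulVec_eq_of_selfCommutator :
    star (C *ᵥ v) ⬝ᵥ (C *ᵥ v) = star (Cᴴ *ᵥ u) ⬝ᵥ (Cᴴ *ᵥ u) := by
  -- Square and take traces.
  have h1 := congrArg (fun X => trace (X * X)) h
  simp only [Matrix.mul_add, Matrix.add_mul, trace_add, trace_mul_vecMulVec] at h1
  rw [trace_mul_comm (vecMulVec v (star v)) (Cᴴ * C),
    trace_mul_comm (vecMulVec u (star u)) (C * Cᴴ)] at h1
  simp only [trace_mul_vecMulVec, vecMulVec_mulVec, dotProduct_smul] at h1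
  have h2 : (Cᴴ * C * (Cᴴ * C)).trace = (C * Cᴴ * (C * Cᴴ)).trace := by
    rw [Matrix.mul_assoc, trace_mul_comm]
    simp only [Matrix.mul_assoc]
  have h3 := norm_eq_of_selfCommutator h
  have h4 : star (C *ᵥ v) ⬝ᵥ (C *ᵥ v) = star v ⬝ᵥ (Cᴴ * C) *ᵥ v := by
    rw [star_mulVec, ← mulVec_mulVec, ← dotProduct_mulVec]
  have h5 : star (Cᴴ *ᵥ u) ⬝ᵥ (Cᴴ *ᵥ u) = star u ⬝ᵥ (C * Cᴴ) *ᵥ u := by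
    rw [star_mulVec, ← mulVec_mulVec, ← dotProduct_mulVec, conjTranspose_conjTranspose]
  rw [h4, h5]
  rw [h2, h3] at h1
  linear_combination (1 / 2 : ℂ) * h1

theorem vecMulVec_eq_of_not_linearIndependent (hd : ¬ LinearIndependent ℂ ![u, v]) :
    vecMulVec v (star v) = vecMulVec u (star u) := by
  have hm := norm_eq_of_selfCommutator h
  rw [LinearIndependent.pair_iff] at hd
  push Not at hd
  obtain ⟨a, b, hab, hne⟩ := hd
  have h1 : a • u = -(b • v) := eq_neg_of_add_eq_zero_left hab
  have h2 : (a * star a) • vecMulVec u (star u) = (b * star b) • vecMulVec v (star v) := by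
    have : vecMulVec (a • u) (star (a • u)) = vecMulVec (b • v) (star (b • v)) := by
      rw [h1]; simp
    simpa [smul_vecMulVec, vecMulVec_smul, smul_smul, mul_comm] using this
  have h3 := congrArg trace h2
  simp only [trace_smul, trace_vecMulVec, smul_eq_mul, dotProduct_comm _ (star _), hm] at h3
  by_cases h0 : star u ⬝ᵥ u = 0
  · rw [h0] at hm
    rw [dotProduct_star_self_eq_zero] at h0 hm
    rw [h0, hm]
  · have h4 := mul_right_cancel₀ h0 h3
    have hb : b * star b ≠ 0 := by
      intro hb
      have hb0 : b = 0 := by simpa using hb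
      rw [hb] at h4
      exact hne (by simpa using h4) hb0
    rw [h4] at h2
    exact (smul_right_injective _ hb h2).symm

/-- Write `γ = α + star β`. Pairing with `u` and `v` gives `γ ‖u‖² + star γ ⟨u, v⟩ = 0`, which says that
`γ u + star γ v` has norm zero. -/
theorem coeff_eq_neg_star (hind : LinearIndependent ℂ ![u, v]) {α β : ℂ}
    (hs : Cᴴ *ᵥ u - C *ᵥ v = α • u + β • v) : β = - star α := by
  have hm := norm_eq_of_selfCommutator h
  have hsv := inner_mulVec_eq_of_selfCommutator h
  have h1 := congrArg (fun x => star u ⬝ᵥ x) hs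
  have h2 := congrArg (fun x => star v ⬝ᵥ x) hs
  simp only [dotProduct_sub, dotProduct_add, dotProduct_smul, smul_eq_mul,
    star_dotProduct_conjTranspose_mulVec] at h1 h2
  have h2' := congrArg star h2
  have hg : star v ⬝ᵥ u = star (star u ⬝ᵥ v) := star_dotProduct v u
  have hmr : star (star u ⬝ᵥ u) = star u ⬝ᵥ u := (star_dotProduct u u).symm
  rw [hm, hsv, hg] at h2'
  simp only [star_sub, star_add, star_mul', star_star, hmr] at h2'
  set γ := α + star β with hγ
  have h3 : γ * (star u ⬝ᵥ u) + star γ * (star u ⬝ᵥ v) = 0 := by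
    simp only [hγ, star_add, star_star]
    linear_combination - h1 - h2'
  have h4 : γ • u + star γ • v = 0 := by
    rw [← dotProduct_star_self_eq_zero, dotProduct_comm]
    simp only [star_add, star_smul, star_star, dotProduct_add, add_dotProduct, smul_dotProduct,
      dotProduct_smul, smul_eq_mul, dotProduct_comm u, dotProduct_comm v, hg, hm]
    have h3' := congrArg star h3
    simp only [star_add, star_mul', star_star, hmr, star_zero] at h3'
    linear_combination star γ * h3 + γ * h3'
  have h5 := (LinearIndependent.pair_iff.mp hind _ _ h4).1
  rw [← star_star β, eq_neg_of_add_eq_zero_right h5, star_neg]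

end trace

section dilation
variable {n : Type*} [Fintype n] [DecidableEq n]

/-- The hypotheses say that `M = [[C, u], [vᴴ, w]]` is normal; the operator is the compression of the
separable one built from `M`. -/
theorem mem_sepCone_of_normal_dilation {C : Matrix n n ℂ} {u v : n → ℂ} {w : ℂ}
    (h : Cᴴ * C + vecMulVec v (star v) = C * Cᴴ + vecMulVec u (star u))
    (hs : Cᴴ *ᵥ u + w • v = C *ᵥ v + star w • u) :
    (Cᴴ * C + vecMulVec v (star v), C, 1) ∈ sepCone n := by
  have hm := norm_eq_of_selfCommutator h
  let M : Matrix (n ⊕ Unit) (n ⊕ Unit) ℂ :=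
    fromBlocks C (replicateCol Unit u) (replicateRow Unit (star v)) (of fun _ _ => w)
  have e11 : (Mᴴ * M).toBlocks₁₁ = Cᴴ * C + vecMulVec v (star v) := by
    simp only [M, fromBlocks_conjTranspose, fromBlocks_multiply, toBlocks_fromBlocks₁₁]
    ext i j
    simp [Matrix.mul_apply, vecMulVec_apply]
  have hM : Mᴴ * M = M * Mᴴ := by
    simp only [M, fromBlocks_conjTranspose, fromBlocks_multiply]
    have hs' := congrArg star hs
    congr 1
    · ext i j
      have := congrFun (congrFun h i) j
      simpa [Matrix.mul_apply, vecMulVec_apply] using this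
    · ext i j
      have := congrFun hs i
      simpa [Matrix.mul_apply, mulVec, dotProduct, mul_comm] using this
    · ext i j
      have := congrFun hs' j
      simpa [Matrix.mul_apply, mulVec, dotProduct, mul_comm] using this
    · ext i j
      have h1 := hm
      simp only [dotProduct, Pi.star_apply] at h1
      simp [Matrix.mul_apply, mul_comm] at h1 ⊢
      exact h1.symm
  let J : Matrix n (n ⊕ Unit) ℂ := of fun i j => if Sum.inl i = j then 1 else 0
  have hc (X : Matrix (n ⊕ Unit) (n ⊕ Unit) ℂ) : J * X * Jᴴ = X.toBlocks₁₁ := by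
    ext i j
    simp [J, Matrix.mul_apply, toBlocks₁₁]
  have := conj_mem_sepCone J (mem_sepCone_of_normal hM)
  rw [hc, hc, hc, e11] at this
  simpa [M, ← fromBlocks_one] using this

end dilation

/-- The triples `u, v, Cᴴ u` and `v, u, C v` have transposed Gram matrices, so their determinants have
equal modulus. In dimension three this means that `Cᴴ u` and `C v` differ, up to a phase, by an
element of the span of `u` and `v`. -/
theorem exists_phase {C : Matrix (Fin 3) (Fin 3) ℂ} {u v : Fin 3 → ℂ}
    (h : Cᴴ * C + vecMulVec v (star v) = C * Cᴴ + vecMulVec u (star u)) :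
    ∃ c : ℂ, c * star c = 1 ∧ (of ![u, v, Cᴴ *ᵥ u - c • C *ᵥ v]).det = 0 := by
  set M₁ : Matrix (Fin 3) (Fin 3) ℂ := of ![u, v, Cᴴ *ᵥ u] with hM₁
  set M₂ : Matrix (Fin 3) (Fin 3) ℂ := of ![v, u, C *ᵥ v] with hM₂
  have hm := norm_eq_of_selfCommutator h
  have hs := inner_mulVec_eq_of_selfCommutator h
  have hn := norm_mulVec_eq_of_selfCommutator h
  have hgram : M₂ * M₂ᴴ = (M₁ * M₁ᴴ)ᵀ := by
    have e (x : Fin 3 → Fin 3 → ℂ) (i j : Fin 3) : (of x * (of x)ᴴ) i j = star (x j) ⬝ᵥ x i :=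
      dotProduct_comm _ _
    have hCv (x : Fin 3 → ℂ) : star (C *ᵥ v) ⬝ᵥ x = star (star x ⬝ᵥ C *ᵥ v) :=
      star_dotProduct _ _
    have hCu (x : Fin 3 → ℂ) : star (Cᴴ *ᵥ u) ⬝ᵥ x = star u ⬝ᵥ C *ᵥ x := by
      rw [star_mulVec, conjTranspose_conjTranspose, dotProduct_mulVec]
    have hu (x : Fin 3 → ℂ) : star x ⬝ᵥ Cᴴ *ᵥ u = star (star u ⬝ᵥ C *ᵥ x) :=
      star_dotProduct_conjTranspose_mulVec _ _ _
    ext i j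
    rw [transpose_apply, e, e]
    fin_cases i <;> fin_cases j <;> simp [hm, hn]
    · rw [hCv, hs, hu]
    · rw [hCv, hu]
    · rw [hCu, hs]
    · rw [hCu]
  have hdet : M₂.det * star M₂.det = M₁.det * star M₁.det := by
    have := congrArg det hgram
    simpa only [det_transpose, det_mul, det_conjTranspose] using this
  have hexp (c : ℂ) : (of ![u, v, Cᴴ *ᵥ u - c • C *ᵥ v]).det = M₁.det + c * M₂.det := by
    simp [hM₁, hM₂, det_fin_three]
    ring
  by_cases h0 : M₂.det = 0
  · refine ⟨1, by simp, ?_⟩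
    have : M₁.det = 0 := by simpa [h0] using hdet
    rw [hexp, h0, this]
    simp
  · refine ⟨-(M₁.det / M₂.det), ?_, ?_⟩
    · have h0' : star M₂.det ≠ 0 := by simpa using h0
      rw [star_neg, star_div₀, neg_mul_neg, div_mul_div_comm, ← hdet,
        div_self (mul_ne_zero h0 h0')]
    · rw [hexp]
      field_simp
      ring

/-- The two defects of `A = Cᴴ C + v vᴴ = C Cᴴ + u uᴴ` have rank one. Replacing `v` by a multiple of
modulus one does not change `A` and makes a normal dilation by one dimension possible. -/
theorem mem_sepCone_of_rank_one_defects {C : Matrix (Fin 3) (Fin 3) ℂ} {u v : Fin 3 → ℂ}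
    (h : Cᴴ * C + vecMulVec v (star v) = C * Cᴴ + vecMulVec u (star u)) :
    (Cᴴ * C + vecMulVec v (star v), C, 1) ∈ sepCone (Fin 3) := by
  -- If `u` and `v` are dependent, they span the same line with the same norm, and `C` is normal.
  by_cases hind : LinearIndependent ℂ ![u, v]
  · obtain ⟨c, hc, hdet⟩ := exists_phase h
    have hc0 : c ≠ 0 := by
      rintro rfl
      simp at hc
    have hcv : vecMulVec (c • v) (star (c • v)) = vecMulVec v (star v) := by
      rw [star_smul, smul_vecMulVec, vecMulVec_smul, smul_smul, hc, one_smul]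
    have h' := h
    rw [← hcv] at h' ⊢
    have hind' : LinearIndependent ℂ ![u, c • v] := by
      rw [LinearIndependent.pair_iff] at hind ⊢
      intro a b hab
      rw [smul_smul] at hab
      obtain ⟨h1, h2⟩ := hind _ _ hab
      exact ⟨h1, by simpa [hc0] using h2⟩
    obtain ⟨k, hk0, hk⟩ := exists_vecMul_eq_zero_iff.mpr hdet
    have hk' : k 0 • u + k 1 • v + k 2 • (Cᴴ *ᵥ u - c • C *ᵥ v) = 0 := by
      ext i
      have := congrFun hk i
      simpa [vecMul, dotProduct, Fin.sum_univ_three] using this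
    have hk2 : k 2 ≠ 0 := by
      intro hk2
      rw [hk2, zero_smul, add_zero] at hk'
      obtain ⟨h1, h2⟩ := LinearIndependent.pair_iff.mp hind _ _ hk'
      apply hk0
      ext i
      fin_cases i <;> simp [h1, h2, hk2]
    have hs : Cᴴ *ᵥ u - C *ᵥ (c • v) = (-(k 0 / k 2)) • u + (-(k 1 / (k 2 * c))) • (c • v) := by
      rw [mulVec_smul]
      ext i
      have := congrFun hk' i
      simp only [Pi.add_apply, Pi.sub_apply, Pi.smul_apply, smul_eq_mul, Pi.zero_apply] at this ⊢
      field_simp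
      linear_combination this
    have hβ := coeff_eq_neg_star h' hind' hs
    rw [hβ] at hs
    generalize -(k 0 / k 2) = α at hs
    refine mem_sepCone_of_normal_dilation (w := star α) h' ?_
    rw [star_star, ← sub_eq_zero]
    rw [← sub_eq_zero] at hs
    rw [← hs, neg_smul]
    abel
  · have hvu := vecMulVec_eq_of_not_linearIndependent h hind
    have hnormal : Cᴴ * C = C * Cᴴ := by
      rw [hvu] at h
      exact add_right_cancel h
    simpa using add_mem (mem_sepCone_of_normal hnormal)
      (mem_sepCone_fst (posSemidef_vecMulVec_self_star v))

/-! ### Positive partial transpose implies separability -/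

/-- Orthogonal projection onto the complement of `x`. For `x = 0` the inverse is `0⁻¹ = 0`, and `E = 1`
is still the right projection. -/
theorem exists_orthogonal_projection {r : ℕ} (x : Fin r → ℂ) :
    ∃ E : Matrix (Fin r) (Fin r) ℂ, Eᴴ = E ∧ E * E = E ∧ E *ᵥ x = 0 ∧
      E = 1 - (star x ⬝ᵥ x)⁻¹ • vecMulVec x (star x) := by
  have hr : star (star x ⬝ᵥ x) = star x ⬝ᵥ x := (star_dotProduct x x).symm
  have hx : ((star x ⬝ᵥ x)⁻¹ * (star x ⬝ᵥ x)) • x = x := by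
    by_cases h : star x ⬝ᵥ x = 0
    · rw [dotProduct_star_self_eq_zero] at h
      simp [h]
    · rw [inv_mul_cancel₀ h, one_smul]
  have hEx : (1 - (star x ⬝ᵥ x)⁻¹ • vecMulVec x (star x)) *ᵥ x = 0 := by
    rw [sub_mulVec, one_mulVec, smul_mulVec, vecMulVec_mulVec, op_smul_eq_smul, smul_smul, hx,
      sub_self]
  refine ⟨_, ?_, ?_, hEx, rfl⟩
  · rw [conjTranspose_sub, conjTranspose_smul, conjTranspose_vecMulVec, star_star, star_inv₀, hr,
      conjTranspose_one]
  · conv_lhs => rw [Matrix.mul_sub, Matrix.mul_smul, mul_vecMulVec, hEx]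
    simp

/-- Positive partial transpose implies separability on `ℂ² ⊗ ℂⁿ`. The operator with blocks
`[[A, Cᴴ], [C, B]]` is positive semidefinite when it is a Gram matrix of block rows `Y₁, Y₂`, and
its partial transpose `[[A, C], [Cᴴ, B]]` is so when it is a Gram matrix of block rows `Z₁, Z₂`. The
column numbers `r` and `s` bound the two ranks, and the induction runs over them. -/
def SepOfPPT (n : ℕ) : Prop :=
  ∀ (r s : ℕ) (Y₁ Y₂ : Matrix (Fin n) (Fin r) ℂ) (Z₁ Z₂ : Matrix (Fin n) (Fin s) ℂ),
    Y₁ * Y₁ᴴ = Z₁ * Z₁ᴴ → Y₂ * Y₂ᴴ = Z₂ * Z₂ᴴ → Y₂ * Y₁ᴴ = Z₁ * Z₂ᴴ →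
      (Y₁ * Y₁ᴴ, Y₂ * Y₁ᴴ, Y₂ * Y₂ᴴ) ∈ sepCone (Fin n)

section steps

variable {n r s : ℕ} {Y₁ Y₂ : Matrix (Fin n) (Fin r) ℂ} {Z₁ Z₂ : Matrix (Fin n) (Fin s) ℂ}

/-- For `E` the projection that removes `Y₁ᴴ y`, this is the Schur complement of `Y₁ Y₁ᴴ` along `y`;
it depends only on the product `Y₁ Y₁ᴴ`. -/
theorem mul_projection_mul {E : Matrix (Fin r) (Fin r) ℂ} {y : Fin n → ℂ}
    (hE : E = 1 - (star (Y₁ᴴ *ᵥ y) ⬝ᵥ (Y₁ᴴ *ᵥ y))⁻¹ • vecMulVec (Y₁ᴴ *ᵥ y) (star (Y₁ᴴ *ᵥ y))) :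
    Y₁ * E * Y₁ᴴ = Y₁ * Y₁ᴴ - (star y ⬝ᵥ (Y₁ * Y₁ᴴ) *ᵥ y)⁻¹ •
      vecMulVec ((Y₁ * Y₁ᴴ) *ᵥ y) (star ((Y₁ * Y₁ᴴ) *ᵥ y)) := by
  have ha : star (Y₁ᴴ *ᵥ y) ⬝ᵥ (Y₁ᴴ *ᵥ y) = star y ⬝ᵥ (Y₁ * Y₁ᴴ) *ᵥ y := by
    rw [star_mulVec, ← mulVec_mulVec, ← dotProduct_mulVec, conjTranspose_conjTranspose]
  rw [hE, ha, Matrix.mul_sub, Matrix.sub_mul, Matrix.mul_one, Matrix.mul_smul, Matrix.smul_mul,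
    mul_vecMulVec, vecMulVec_mul, ← mulVec_mulVec, star_mulVec Y₁]

/-- If `B y = 0`, then `C y = Cᴴ y = 0`. Subtracting from `A` the rank one matrix
`(A y) (A y)ᴴ / ⟨y, A y⟩`, which is a product term, keeps both positivity conditions and makes all
blocks vanish on `y`, so that one dimension can be split off. -/
theorem mem_sepCone_of_det_eq_zero {n : ℕ} (ih : SepOfPPT n)
    {Y₁ Y₂ : Matrix (Fin (n + 1)) (Fin r) ℂ} {Z₁ Z₂ : Matrix (Fin (n + 1)) (Fin s) ℂ}
    (hA : Y₁ * Y₁ᴴ = Z₁ * Z₁ᴴ) (hB : Y₂ * Y₂ᴴ = Z₂ * Z₂ᴴ) (hC : Y₂ * Y₁ᴴ = Z₁ * Z₂ᴴ)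
    (hdet : (Y₂ * Y₂ᴴ).det = 0) : (Y₁ * Y₁ᴴ, Y₂ * Y₁ᴴ, Y₂ * Y₂ᴴ) ∈ sepCone (Fin (n + 1)) := by
  obtain ⟨V, y, -, hV, -, hBy⟩ :=
    exists_isometry_of_det_eq_zero (isHermitian_mul_conjTranspose_self Y₂) hdet
  have hY₂ : Y₂ᴴ *ᵥ y = 0 := by rwa [← self_mul_conjTranspose_mulVec_eq_zero]
  have hZ₂ : Z₂ᴴ *ᵥ y = 0 := by rwa [← self_mul_conjTranspose_mulVec_eq_zero, ← hB]
  obtain ⟨E, hEH, hEE, hEy, hE⟩ := exists_orthogonal_projection (Y₁ᴴ *ᵥ y)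
  obtain ⟨F, hFH, hFF, -, hF⟩ := exists_orthogonal_projection (Z₁ᴴ *ᵥ y)
  have hY₁E := mul_projection_mul hE
  have hZ₁F := mul_projection_mul hF
  rw [← hA, ← hY₁E] at hZ₁F
  have hCy : (Y₂ * Y₁ᴴ) *ᵥ y = 0 := by rw [hC, ← mulVec_mulVec, hZ₂, mulVec_zero]
  have hCy' : (Y₂ * Y₁ᴴ)ᴴ *ᵥ y = 0 := by
    rw [conjTranspose_mul, conjTranspose_conjTranspose, ← mulVec_mulVec, hY₂, mulVec_zero]
  have hY₂E : Y₂ * E = Y₂ := by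
    rw [hE, Matrix.mul_sub, Matrix.mul_smul, mul_vecMulVec, mulVec_mulVec, hCy]
    simp
  have hZ₂F : Z₂ * F = Z₂ := by
    have : Z₂ *ᵥ (Z₁ᴴ *ᵥ y) = 0 := by
      rw [← hCy', hC, conjTranspose_mul, conjTranspose_conjTranspose, mulVec_mulVec]
    rw [hF, Matrix.mul_sub, Matrix.mul_smul, mul_vecMulVec, this]
    simp
  have hFZ₂ : F * Z₂ᴴ = Z₂ᴴ := by
    simpa [hFH] using congrArg conjTranspose hZ₂F
  have e1 : Vᴴ * Y₁ * E * (Vᴴ * Y₁ * E)ᴴ = Vᴴ * (Y₁ * E * Y₁ᴴ) * V := by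
    simp only [conjTranspose_mul, conjTranspose_conjTranspose, hEH]
    rw [← Matrix.mul_assoc, Matrix.mul_assoc _ E E, hEE]
    simp only [Matrix.mul_assoc]
  have e2 : Vᴴ * Z₁ * F * (Vᴴ * Z₁ * F)ᴴ = Vᴴ * (Z₁ * F * Z₁ᴴ) * V := by
    simp only [conjTranspose_mul, conjTranspose_conjTranspose, hFH]
    rw [← Matrix.mul_assoc, Matrix.mul_assoc _ F F, hFF]
    simp only [Matrix.mul_assoc]
  have e3 : Vᴴ * Y₂ * (Vᴴ * Y₂)ᴴ = Vᴴ * (Y₂ * Y₂ᴴ) * V := by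
    simp only [conjTranspose_mul, conjTranspose_conjTranspose, Matrix.mul_assoc]
  have e4 : Vᴴ * Z₂ * (Vᴴ * Z₂)ᴴ = Vᴴ * (Z₂ * Z₂ᴴ) * V := by
    simp only [conjTranspose_mul, conjTranspose_conjTranspose, Matrix.mul_assoc]
  have e5 : Vᴴ * Y₂ * (Vᴴ * Y₁ * E)ᴴ = Vᴴ * (Y₂ * Y₁ᴴ) * V := by
    simp only [conjTranspose_mul, conjTranspose_conjTranspose, hEH]
    rw [← Matrix.mul_assoc, Matrix.mul_assoc _ Y₂ E, hY₂E]
    simp only [Matrix.mul_assoc]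
  have e6 : Vᴴ * Z₁ * F * (Vᴴ * Z₂)ᴴ = Vᴴ * (Z₁ * Z₂ᴴ) * V := by
    simp only [conjTranspose_mul, conjTranspose_conjTranspose]
    rw [← Matrix.mul_assoc, Matrix.mul_assoc _ F, hFZ₂]
    simp only [Matrix.mul_assoc]
  have key := conj_mem_sepCone V
    (ih r s (Vᴴ * Y₁ * E) (Vᴴ * Y₂) (Vᴴ * Z₁ * F) (Vᴴ * Z₂)
      (by rw [e1, e2, hZ₁F]) (by rw [e3, e4, hB]) (by rw [e5, e6, hC]))
  have hAy : (Y₁ * E * Y₁ᴴ) *ᵥ y = 0 := by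
    rw [← mulVec_mulVec, ← mulVec_mulVec, hEy, mulVec_zero]
  have hAH : (Y₁ * E * Y₁ᴴ)ᴴ = Y₁ * E * Y₁ᴴ := by
    simp only [conjTranspose_mul, conjTranspose_conjTranspose, hEH, Matrix.mul_assoc]
  rw [e1, e3, e5, conj_compress_eq hV hAy (by rwa [hAH]), conj_compress_eq hV hCy hCy',
    conj_compress_eq hV hBy (by rwa [(isHermitian_mul_conjTranspose_self Y₂).eq]), hY₁E] at key
  have hpsd : ((star y ⬝ᵥ (Y₁ * Y₁ᴴ) *ᵥ y)⁻¹ •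
      vecMulVec ((Y₁ * Y₁ᴴ) *ᵥ y) (star ((Y₁ * Y₁ᴴ) *ᵥ y))).PosSemidef :=
    (posSemidef_vecMulVec_self_star _).smul
      (inv_nonneg.mpr ((posSemidef_self_mul_conjTranspose Y₁).dotProduct_mulVec_nonneg y))
  simpa using add_mem key (mem_sepCone_fst hpsd)

theorem eq_smul_one_of_posSemidef {m : Type*} [Fintype m] [DecidableEq m] {H : Matrix m m ℂ}
    {μ ν : ℝ} (h1 : (H - (μ : ℂ) • 1).PosSemidef) (h2 : (-H - (ν : ℂ) • 1).PosSemidef)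
    (h : 0 ≤ μ + ν) : H = (μ : ℂ) • 1 := by
  have h3 : ((μ + ν : ℂ) • (1 : Matrix m m ℂ)).PosSemidef :=
    PosSemidef.one.smul (by exact_mod_cast h)
  have h4 := (h2.add h3).trace_nonneg
  have h5 : -H - (ν : ℂ) • 1 + (μ + ν : ℂ) • (1 : Matrix m m ℂ) = -(H - (μ : ℂ) • 1) := by
    module
  rw [h5, trace_neg, neg_nonneg] at h4
  exact sub_eq_zero.mp (h1.trace_eq_zero_iff.mp (le_antisymm h4 h1.trace_nonneg))

/-- Shifting the perturbation `(H, K)` by its smallest, respectively largest, eigenvalue exhibits the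
operator as a positive combination of two operators of smaller total rank. -/
theorem mem_sepCone_of_large
    (ih : ∀ (r' s' : ℕ), r' + s' < r + s → ∀ (Y₁ Y₂ : Matrix (Fin n) (Fin r') ℂ)
      (Z₁ Z₂ : Matrix (Fin n) (Fin s') ℂ), Y₁ * Y₁ᴴ = Z₁ * Z₁ᴴ → Y₂ * Y₂ᴴ = Z₂ * Z₂ᴴ →
      Y₂ * Y₁ᴴ = Z₁ * Z₂ᴴ → (Y₁ * Y₁ᴴ, Y₂ * Y₁ᴴ, Y₂ * Y₂ᴴ) ∈ sepCone (Fin n))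
    (hA : Y₁ * Y₁ᴴ = Z₁ * Z₁ᴴ) (hB : Y₂ * Y₂ᴴ = Z₂ * Z₂ᴴ) (hC : Y₂ * Y₁ᴴ = Z₁ * Z₂ᴴ)
    (h : 4 * n ^ 2 + 2 ≤ r ^ 2 + s ^ 2) :
    (Y₁ * Y₁ᴴ, Y₂ * Y₁ᴴ, Y₂ * Y₂ᴴ) ∈ sepCone (Fin n) := by
  obtain ⟨H, K, hH, hK, hns, h11, h22, h21⟩ := exists_hermitian_pair Y₁ Y₂ Z₁ Z₂ h
  have hrs : 0 < r + s := by
    by_contra hrs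
    obtain ⟨rfl, rfl⟩ : r = 0 ∧ s = 0 := by omega
    simp at h
  have step {H : Matrix (Fin r) (Fin r) ℂ} {K : Matrix (Fin s) (Fin s) ℂ} {μ : ℝ}
      (h11 : Y₁ * H * Y₁ᴴ = Z₁ * K * Z₁ᴴ) (h22 : Y₂ * H * Y₂ᴴ = Z₂ * K * Z₂ᴴ)
      (h21 : Y₂ * H * Y₁ᴴ = Z₁ * K * Z₂ᴴ) (hH : (H - (μ : ℂ) • 1).PosSemidef)
      (hK : (K - (μ : ℂ) • 1).PosSemidef)
      (hdet : (H - (μ : ℂ) • 1).det = 0 ∨ (K - (μ : ℂ) • 1).det = 0) :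
      (Y₁ * H * Y₁ᴴ - (μ : ℂ) • (Y₁ * Y₁ᴴ), Y₂ * H * Y₁ᴴ - (μ : ℂ) • (Y₂ * Y₁ᴴ),
        Y₂ * H * Y₂ᴴ - (μ : ℂ) • (Y₂ * Y₂ᴴ)) ∈ sepCone (Fin n) := by
    obtain ⟨r', s', G, L, hlt, hG, hL⟩ := exists_fewer_columns hH hK hdet
    have eG (P Q : Matrix (Fin n) (Fin r) ℂ) :
        P * G * (Q * G)ᴴ = P * H * Qᴴ - (μ : ℂ) • (P * Qᴴ) := by
      rw [conjTranspose_mul, Matrix.mul_assoc, ← Matrix.mul_assoc G, ← hG]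
      simp [Matrix.mul_sub, Matrix.sub_mul, Matrix.mul_assoc]
    have eL (P Q : Matrix (Fin n) (Fin s) ℂ) :
        P * L * (Q * L)ᴴ = P * K * Qᴴ - (μ : ℂ) • (P * Qᴴ) := by
      rw [conjTranspose_mul, Matrix.mul_assoc, ← Matrix.mul_assoc L, ← hL]
      simp [Matrix.mul_sub, Matrix.sub_mul, Matrix.mul_assoc]
    have := ih r' s' hlt (Y₁ * G) (Y₂ * G) (Z₁ * L) (Z₂ * L) (by rw [eG, eL, h11, hA])
      (by rw [eG, eL, h22, hB]) (by rw [eG, eL, h21, hC])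
    rwa [eG, eG, eG] at this
  obtain ⟨μ, hμH, hμK, hμ⟩ := exists_common_shift hrs hH hK
  obtain ⟨ν, hνH, hνK, hν⟩ := exists_common_shift hrs hH.neg hK.neg
  have hpos : μ + ν < 0 := by
    by_contra! hcon
    exact hns ⟨μ, eq_smul_one_of_posSemidef hμH hνH hcon, eq_smul_one_of_posSemidef hμK hνK hcon⟩
  have m1 := step h11 h22 h21 hμH hμK hμ
  have m2 := step (H := -H) (K := -K) (by simp [h11]) (by simp [h22]) (by simp [h21]) hνH hνK hν
  have m12 := add_mem m1 m2
  rw [Prod.mk_add_mk, Prod.mk_add_mk] at m12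
  have key := smul_mem_sepCone (c := (-(μ + ν))⁻¹) (inv_nonneg.mpr (by linarith)) m12
  have e (P Q : Matrix (Fin n) (Fin r) ℂ) : (((-(μ + ν))⁻¹ : ℝ) : ℂ) •
      (P * H * Qᴴ - (μ : ℂ) • (P * Qᴴ) + (P * -H * Qᴴ - (ν : ℂ) • (P * Qᴴ))) = P * Qᴴ := by
    have h1 : P * H * Qᴴ - (μ : ℂ) • (P * Qᴴ) + (P * -H * Qᴴ - (ν : ℂ) • (P * Qᴴ)) =
        ((-(μ + ν) : ℝ) : ℂ) • (P * Qᴴ) := by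
      rw [Matrix.mul_neg, Matrix.neg_mul]
      push_cast
      module
    rw [h1, smul_smul, ← Complex.ofReal_mul, inv_mul_cancel₀ (by linarith), Complex.ofReal_one,
      one_smul]
  rwa [e, e, e] at key

theorem posSemidef_one_sub {Z : Matrix (Fin n) (Fin s) ℂ} (hZ : Z * Zᴴ = 1) :
    (1 - Zᴴ * Z).PosSemidef := by
  have e : 1 - Zᴴ * Z = (1 - Zᴴ * Z)ᴴ * (1 - Zᴴ * Z) := by
    have : Zᴴ * Z * (Zᴴ * Z) = Zᴴ * Z := by
      rw [Matrix.mul_assoc, ← Matrix.mul_assoc Z, hZ, Matrix.one_mul]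
    simp [Matrix.mul_sub, Matrix.sub_mul, this]
  rw [e]
  exact posSemidef_conjTranspose_mul_self _

theorem conjTranspose_mul_self_eq_of_add_eq_one {P : Matrix (Fin r) (Fin r) ℂ}
    (hP : Y₂ᴴ * Y₂ + P = 1) : Y₁ * Y₁ᴴ = (Y₂ * Y₁ᴴ)ᴴ * (Y₂ * Y₁ᴴ) + Y₁ * P * Y₁ᴴ := by
  rw [eq_sub_of_add_eq' hP]
  simp [Matrix.mul_sub, Matrix.sub_mul, Matrix.mul_assoc]

theorem mem_sepCone_of_square {Y₁ Y₂ : Matrix (Fin n) (Fin n) ℂ}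
    (hA : Y₁ * Y₁ᴴ = Z₁ * Z₁ᴴ) (hB : Y₂ * Y₂ᴴ = Z₂ * Z₂ᴴ) (hC : Y₂ * Y₁ᴴ = Z₁ * Z₂ᴴ)
    (h1 : Y₂ * Y₂ᴴ = 1) : (Y₁ * Y₁ᴴ, Y₂ * Y₁ᴴ, 1) ∈ sepCone (Fin n) := by
  refine mem_sepCone_of_defect ?_ ?_
  · simpa using conjTranspose_mul_self_eq_of_add_eq_one (Y₁ := Y₁) (Y₂ := Y₂) (P := 0)
      (by simpa using mul_eq_one_comm.mp h1)
  · have e := conjTranspose_mul_self_eq_of_add_eq_one (Y₁ := Z₁) (add_sub_cancel (Z₂ᴴ * Z₂) 1)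
    have hC' : Z₂ * Z₁ᴴ = (Y₂ * Y₁ᴴ)ᴴ := by simp [hC]
    rw [hC', conjTranspose_conjTranspose, ← hA] at e
    rw [e, add_sub_cancel_left]
    exact (posSemidef_one_sub (hB ▸ h1)).mul_mul_conjTranspose_same Z₁

theorem mem_sepCone_of_small (hn : n ≤ 3)
    (hA : Y₁ * Y₁ᴴ = Z₁ * Z₁ᴴ) (hB : Y₂ * Y₂ᴴ = Z₂ * Z₂ᴴ) (hC : Y₂ * Y₁ᴴ = Z₁ * Z₂ᴴ)
    (h1 : Y₂ * Y₂ᴴ = 1) (h : r ^ 2 + s ^ 2 ≤ 4 * n ^ 2 + 1) :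
    (Y₁ * Y₁ᴴ, Y₂ * Y₁ᴴ, 1) ∈ sepCone (Fin n) := by
  have hnr := card_le_of_mul_conjTranspose_eq_one h1
  have hns := card_le_of_mul_conjTranspose_eq_one (hB ▸ h1)
  have hC' : Z₂ * Z₁ᴴ = (Y₂ * Y₁ᴴ)ᴴ := by simp [hC]
  obtain rfl | hr := hnr.eq_or_lt
  · exact mem_sepCone_of_square hA hB hC h1
  obtain rfl | hs := hns.eq_or_lt
  · have := conjTranspose_mem_sepCone (mem_sepCone_of_square hA.symm hB.symm
      (by simpa using congrArg conjTranspose hC.symm) (hB ▸ h1))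
    rwa [hC', conjTranspose_conjTranspose, ← hA] at this
  -- Both ranks exceed `n`; with `n ≤ 3` the bound leaves only `n = 3` and `r = s = 4`.
  obtain ⟨rfl, rfl, rfl⟩ : n = 3 ∧ r = 4 ∧ s = 4 := by
    have hr' : r ≤ 6 := by nlinarith
    have hs' : s ≤ 6 := by nlinarith
    interval_cases n <;> interval_cases r <;> interval_cases s <;> simp_all
  obtain ⟨v, hv⟩ := exists_conjTranspose_mul_add_vecMulVec_eq_one h1
  obtain ⟨u, hu⟩ := exists_conjTranspose_mul_add_vecMulVec_eq_one (hB ▸ h1)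
  have e1 := conjTranspose_mul_self_eq_of_add_eq_one (Y₁ := Y₁) hv
  have e2 := conjTranspose_mul_self_eq_of_add_eq_one (Y₁ := Z₁) hu
  rw [mul_vecMulVec, vecMulVec_mul, ← star_mulVec] at e1 e2
  rw [hC', conjTranspose_conjTranspose] at e2
  rw [e1]
  exact mem_sepCone_of_rank_one_defects (e1.symm.trans (hA.trans e2))

end steps

/-- **Størmer–Woronowicz theorem**: on `ℂ² ⊗ ℂⁿ` with `n ≤ 3`, an operator that is positive
semidefinite together with its partial transpose is separable. -/
theorem sepOfPPT : ∀ n ≤ 3, SepOfPPT n := by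
  intro n
  induction n with
  | zero =>
    intro _ r s Y₁ Y₂ Z₁ Z₂ _ _ _
    convert zero_mem (sepCone (Fin 0)) <;> exact Subsingleton.elim _ _
  | succ n ihn =>
    intro hn r s
    induction hrs : r + s using Nat.strong_induction_on generalizing r s with
    | _ k ih =>
      intro Y₁ Y₂ Z₁ Z₂ hA hB hC
      subst hrs
      by_cases hdet : (Y₂ * Y₂ᴴ).det = 0
      · exact mem_sepCone_of_det_eq_zero (ihn (by omega)) hA hB hC hdet
      by_cases hlarge : 4 * (n + 1) ^ 2 + 2 ≤ r ^ 2 + s ^ 2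
      · exact mem_sepCone_of_large (fun r' s' hlt => ih _ hlt r' s' rfl) hA hB hC hlarge
      -- A local change of basis turns the invertible block `B` into the identity.
      obtain ⟨R, hR⟩ := exists_eq_mul_conjTranspose (posSemidef_self_mul_conjTranspose Y₂)
      have hRdet : IsUnit R.det := by
        rw [isUnit_iff_ne_zero]
        intro h0
        rw [hR, det_mul, h0, zero_mul] at hdet
        exact hdet rfl
      have hS : R * R⁻¹ = 1 := mul_nonsing_inv R hRdet
      have hS' : R⁻¹ * R = 1 := nonsing_inv_mul R hRdet
      have hSH : (R⁻¹)ᴴ * Rᴴ = 1 := by rw [← conjTranspose_mul, hS, conjTranspose_one]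
      have hSH' : Rᴴ * (R⁻¹)ᴴ = 1 := by rw [← conjTranspose_mul, hS', conjTranspose_one]
      have e {t : ℕ} (P Q : Matrix (Fin (n + 1)) (Fin t) ℂ) :
          R⁻¹ * P * (R⁻¹ * Q)ᴴ = R⁻¹ * (P * Qᴴ) * (R⁻¹)ᴴ := by
        simp only [conjTranspose_mul, Matrix.mul_assoc]
      have e' (X : Matrix (Fin (n + 1)) (Fin (n + 1)) ℂ) : R * (R⁻¹ * X * (R⁻¹)ᴴ) * Rᴴ = X := by
        simp only [← Matrix.mul_assoc]
        rw [hS, Matrix.one_mul, Matrix.mul_assoc, hSH, Matrix.mul_one]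
      have h1 : R⁻¹ * (Y₂ * Y₂ᴴ) * (R⁻¹)ᴴ = 1 := by
        rw [hR, ← Matrix.mul_assoc, hS', Matrix.one_mul, hSH']
      have := conj_mem_sepCone R (mem_sepCone_of_small (Y₁ := R⁻¹ * Y₁) (Y₂ := R⁻¹ * Y₂)
        (Z₁ := R⁻¹ * Z₁) (Z₂ := R⁻¹ * Z₂) hn (by rw [e, e, hA]) (by rw [e, e, hB])
        (by rw [e, e, hC]) (by rw [e, h1]) (by omega))
      rwa [e, e, ← h1, e', e', e'] at this

/-! ### Operators of Schmidt number two -/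

theorem isSeparableState_kronecker {n m : ℕ} {A : Matrix (Fin n) (Fin n) ℂ}
    {B : Matrix (Fin m) (Fin m) ℂ} (hA : A.PosSemidef) (hB : B.PosSemidef) :
    IsSeparableState (A ⊗ₖ B) :=
  ⟨1, fun _ => A, fun _ => B, fun _ => hA, fun _ => hB, by simp⟩

theorem isSeparableState_zero {n m : ℕ} :
    IsSeparableState (0 : Matrix (Fin n × Fin m) (Fin n × Fin m) ℂ) :=
  ⟨0, Fin.elim0, Fin.elim0, fun j => j.elim0, fun j => j.elim0, by simp⟩

theorem IsSeparableState.add {n m : ℕ} {σ τ : Matrix (Fin n × Fin m) (Fin n × Fin m) ℂ}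
    (hσ : IsSeparableState σ) (hτ : IsSeparableState τ) : IsSeparableState (σ + τ) := by
  obtain ⟨r, A, B, hA, hB, rfl⟩ := hσ
  obtain ⟨s, A', B', hA', hB', rfl⟩ := hτ
  refine ⟨r + s, Fin.append A A', Fin.append B B', fun j => ?_, fun j => ?_, ?_⟩
  · induction j using Fin.addCases <;> simp [hA, hA']
  · induction j using Fin.addCases <;> simp [hB, hB']
  · simp [Fin.sum_univ_add]

theorem isSeparableState_sum {n m : ℕ} {ι : Type*} (s : Finset ι)
    {σ : ι → Matrix (Fin n × Fin m) (Fin n × Fin m) ℂ} (h : ∀ i ∈ s, IsSeparableState (σ i)) :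
    IsSeparableState (∑ i ∈ s, σ i) :=
  Finset.sum_induction σ IsSeparableState (fun _ _ => IsSeparableState.add)
    isSeparableState_zero h

/-- A local map `L : ℂ² → ℂⁿ` sends separable operators on `ℂ² ⊗ ℂᵐ` to separable operators on
`ℂⁿ ⊗ ℂᵐ`. -/
theorem isSeparableState_of_mem_sepCone {n m : ℕ} (L : Matrix (Fin n) (Fin 2) ℂ)
    {A C B : Matrix (Fin m) (Fin m) ℂ} (h : (A, C, B) ∈ sepCone (Fin m)) :
    IsSeparableState (of fun x y : Fin n × Fin m =>
      L x.1 0 * star (L y.1 0) * A x.2 y.2 + L x.1 0 * star (L y.1 1) * Cᴴ x.2 y.2 +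
      L x.1 1 * star (L y.1 0) * C x.2 y.2 + L x.1 1 * star (L y.1 1) * B x.2 y.2) := by
  suffices H : ∀ T ∈ sepCone (Fin m), IsSeparableState (of fun x y : Fin n × Fin m =>
      L x.1 0 * star (L y.1 0) * T.1 x.2 y.2 + L x.1 0 * star (L y.1 1) * T.2.1ᴴ x.2 y.2 +
      L x.1 1 * star (L y.1 0) * T.2.1 x.2 y.2 + L x.1 1 * star (L y.1 1) * T.2.2 x.2 y.2) from
    H (A, C, B) h
  intro T hT
  induction hT using AddSubmonoid.closure_induction with
  | mem T hT =>
    obtain ⟨a, b, P, hP, rfl⟩ := hT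
    convert isSeparableState_kronecker
      (posSemidef_vecMulVec_self_star fun i => L i 0 * a + L i 1 * b) hP using 1
    ext x y
    simp only [of_apply, conjTranspose_smul, hP.1.eq, Matrix.smul_apply, smul_eq_mul,
      kroneckerMap_apply, vecMulVec_apply, Pi.star_apply, star_add, star_mul', star_star]
    ring
  | zero =>
    convert isSeparableState_zero (n := n) (m := m) using 1
    ext x y
    simp
  | add T U _ _ hT hU =>
    convert hT.add hU using 1
    ext x y
    simp only [of_apply, Prod.fst_add, Prod.snd_add, conjTranspose_add, Matrix.add_apply]
    ring

theorem exists_factorization_of_rank_le {n k : ℕ} {M : Matrix (Fin n) (Fin (k + 1)) ℂ}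
    (hM : M.rank ≤ k) :
    ∃ (L : Matrix (Fin n) (Fin k) ℂ) (R : Matrix (Fin k) (Fin (k + 1)) ℂ), M = L * R := by
  have hdet : (Mᴴ * M).det = 0 := by
    by_contra h
    have h1 := rank_of_isUnit (Mᴴ * M) ((isUnit_iff_isUnit_det _).mpr (isUnit_iff_ne_zero.mpr h))
    rw [rank_conjTranspose_mul_self, Fintype.card_fin] at h1
    omega
  obtain ⟨V, y, -, hV, -, hy⟩ :=
    exists_isometry_of_det_eq_zero (isHermitian_conjTranspose_mul_self M) hdet
  rw [conjTranspose_mul_self_mulVec_eq_zero] at hy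
  refine ⟨M * V, Vᴴ, ?_⟩
  rw [Matrix.mul_assoc, eq_sub_of_add_eq hV, Matrix.mul_sub, mul_vecMulVec, hy]
  simp

theorem exists_block_factorization {k m : ℕ} {X : Matrix (Fin k × Fin m) (Fin k × Fin m) ℂ}
    (hX : X.PosSemidef) : ∃ Y : Fin k → Matrix (Fin m) (Fin (k * m)) ℂ,
      ∀ i j, (of fun a b => X (i, a) (j, b)) = Y i * (Y j)ᴴ := by
  obtain ⟨R, rfl⟩ := exists_eq_mul_conjTranspose hX
  refine ⟨fun i => of fun a t => R (i, a) (finProdFinEquiv.symm t), fun i j => ?_⟩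
  ext a b
  simp only [of_apply, Matrix.mul_apply, conjTranspose_apply]
  exact (finProdFinEquiv.symm.sum_comp fun t => R (i, a) t * star (R (j, b) t)).symm

/-- A vector of Schmidt rank at most two is `(L ⊗ 1) χ` with `χ ∈ ℂ² ⊗ ℂ³`; the image of `χ χᴴ` under
`I₂ ⊗ φ` has positive partial transpose because `φ` is a PPT map. -/
theorem isSeparableState_idTensor_of_schmidtRank_le_two {n : ℕ}
    {φ : Matrix (Fin 3) (Fin 3) ℂ →ₗ[ℂ] Matrix (Fin 3) (Fin 3) ℂ} (hφ : IsPPTMap φ)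
    {ψ : Fin n × Fin 3 → ℂ} (hψ : schmidtRank ψ ≤ 2) :
    IsSeparableState (idTensor n φ (vecMulVec ψ (star ψ))) := by
  obtain ⟨L, R, hLR⟩ := exists_factorization_of_rank_le hψ
  let χ : Fin 2 × Fin 3 → ℂ := fun x => R x.1 x.2
  let T : Fin 2 → Fin 2 → Matrix (Fin 3) (Fin 3) ℂ := fun k l =>
    φ (vecMulVec (R k) (star (R l)))
  obtain ⟨Y, hY⟩ := exists_block_factorization (hφ.1 2 _ (posSemidef_vecMulVec_self_star χ))
  obtain ⟨W, hW⟩ := exists_block_factorization (hφ.2 2 _ (posSemidef_vecMulVec_self_star χ))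
  have hTY (k l : Fin 2) : T k l = Y k * (Y l)ᴴ := hY k l
  have hTW (k l : Fin 2) : (T k l)ᵀ = W k * (W l)ᴴ := hW k l
  -- Transposing the factorization of the partial transpose on `ℂ³` gives one of the partial
  -- transpose on `ℂ²`.
  have hTZ (k l : Fin 2) : T k l = (W l)ᴴᵀ * ((W k)ᴴᵀ)ᴴ := by
    rw [← transpose_transpose (T k l), hTW, transpose_mul]
    congr 1
    ext
    simp
  have key := sepOfPPT 3 le_rfl _ _ (Y 0) (Y 1) (W 0)ᴴᵀ (W 1)ᴴᵀ
    (by rw [← hTY, ← hTZ]) (by rw [← hTY, ← hTZ]) (by rw [← hTY, ← hTZ])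
  convert isSeparableState_of_mem_sepCone L key using 1
  have hC : (Y 1 * (Y 0)ᴴ)ᴴ = T 0 1 := by
    rw [conjTranspose_mul, conjTranspose_conjTranspose, hTY]
  rw [hC, ← hTY, ← hTY, ← hTY]
  ext x y
  have hψ' (i : Fin n) (a : Fin 3) : ψ (i, a) = L i 0 * R 0 a + L i 1 * R 1 a := by
    have := congrFun (congrFun hLR i) a
    simpa [Matrix.mul_apply, Fin.sum_univ_two] using this
  have hblock : (of fun a b => vecMulVec ψ (star ψ) (x.1, a) (y.1, b)) =
      (L x.1 0 * star (L y.1 0)) • vecMulVec (R 0) (star (R 0)) +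
      (L x.1 0 * star (L y.1 1)) • vecMulVec (R 0) (star (R 1)) +
      (L x.1 1 * star (L y.1 0)) • vecMulVec (R 1) (star (R 0)) +
      (L x.1 1 * star (L y.1 1)) • vecMulVec (R 1) (star (R 1)) := by
    ext a b
    simp only [of_apply, vecMulVec_apply, Pi.star_apply, hψ', Matrix.add_apply,
      Matrix.smul_apply, smul_eq_mul, star_add, star_mul']
    ring
  change φ (of fun a b => vecMulVec ψ (star ψ) (x.1, a) (y.1, b)) x.2 y.2 = _
  rw [hblock]
  simp only [map_add, map_smul, Matrix.add_apply, Matrix.smul_apply, smul_eq_mul, of_apply, T]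

theorem theorem3 (n : ℕ)
    (φ₁ φ₂ : Matrix (Fin 3) (Fin 3) ℂ →ₗ[ℂ] Matrix (Fin 3) (Fin 3) ℂ)
    (hφ₁ : IsPPTMap φ₁) (hφ₂ : IsCompletelyPositive φ₂)
    (ρ : Matrix (Fin n × Fin 3) (Fin n × Fin 3) ℂ) (hρ : ρ.PosSemidef)
    (hS : SchmidtNumberLE 2 (idTensor n φ₂ ρ)) :
    IsSeparableState (idTensor n (φ₁ ∘ₗ φ₂) ρ) := by
  obtain ⟨r, ψ, hψ, hσ⟩ := hS
  have hcomp : idTensor n (φ₁ ∘ₗ φ₂) ρ = idTensor n φ₁ (idTensor n φ₂ ρ) := rfl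
  rw [hcomp, hσ, map_sum]
  exact isSeparableState_sum _ fun j _ =>
    isSeparableState_idTensor_of_schmidtRank_le_two hφ₁ (hψ j)
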